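/- **Theorem 1.** Let $\mathscr H$ be a complex Hilbert space, finite or infinite dimensional, and let $\mathbb P\mathscr H$ be its projective space, the manifold of complex lines $L\subset\mathscr H$, with tangent spaces $T_L\mathbb P\mathscr H\cong\operatorname{Hom}_{\mathbb C}(L,L^\perp)$. (The charts are the maps sending a line that is the graph of a linear map $f\colon L\to L^\perp$ to $f$.) Let $p\colon\mathbb P\mathscr H\times\mathbb P\mathscr H\to[0,1]$ be the transition probability, $p(L_1,L_2)=|\langle\psi_1,\psi_2\rangle|^2$ for unit vectors $\psi_i\in L_i$. Equip $\mathbb P\mathscr H$ with the Fubini–Study Riemannian metric, normalized so that complex projective lines are round 2-spheres of unit radius, that is, $g_L(f_1,f_2)=4\operatorname{Re}\operatorname{Tr}(f_1^*f_2)$ for $f_1,f_2\in\operatorname{Hom}_{\mathbb C}(L,L^\perp)$, and let $d(L_1,L_2)$ be the associated distance, the infimum of the lengths of $C^1$ curves in $\mathbb P\mathscr H$ from $L_1$ to $L_2$. Then for all $L_1,L_2\in\mathbb P\mathscr H$ the distance $d(L_1,L_2)$ is finite and $$\cos\bigl(d(L_1,L_2)\bigr)=2\,p(L_1,L_2)-1,\qquad\text{equivalently}\qquad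 p(L_1,L_2)=\cos^2\bigl(d(L_1,L_2)/2\bigr).$$ -/

import Mathlib

open scoped LinearAlgebra.Projectivization ENNReal Topology InnerProductSpace

noncomputable section

namespace FubiniStudy

variable {H : Type*} [NormedAddCommGroup H] [InnerProductSpace ℂ H]

/-- A unit vector in the line `L`. -/
def unitVec (L : ℙ ℂ H) : H := ((‖L.rep‖⁻¹ : ℝ) : ℂ) • L.rep

/-- The transition probability `p(L₁, L₂) = |⟨ψ₁, ψ₂⟩|²`, where `ψᵢ` is a unit vector in `Lᵢ`.
It does not depend on the unit vectors, see `transitionProb_eq`. -/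
def transitionProb (L₁ L₂ : ℙ ℂ H) : ℝ := ‖⟪unitVec L₁, unitVec L₂⟫_ℂ‖ ^ 2

lemma mem_submodule_iff (L : ℙ ℂ H) (x : H) : x ∈ L.submodule ↔ ∃ c : ℂ, c • L.rep = x := by
  rw [Projectivization.submodule_eq, Submodule.mem_span_singleton]

lemma exists_phase (L : ℙ ℂ H) {ψ : H} (hψ : ψ ∈ L.submodule) (h1 : ‖ψ‖ = 1) :
    ∃ c : ℂ, ‖c‖ = 1 ∧ ψ = c • unitVec L := by
  obtain ⟨c, rfl⟩ := (mem_submodule_iff L ψ).1 hψ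
  have hr : ‖L.rep‖ ≠ 0 := norm_ne_zero_iff.2 L.rep_nonzero
  refine ⟨c * (‖L.rep‖ : ℂ), ?_, ?_⟩
  · rw [norm_smul] at h1
    simpa using h1
  · have hr' : (‖L.rep‖ : ℂ) ≠ 0 := by exact_mod_cast hr
    rw [unitVec, smul_smul]
    congr 1
    push_cast
    field_simp

/-- The transition probability may be computed with arbitrary unit vectors in the two lines. -/
theorem transitionProb_eq (L₁ L₂ : ℙ ℂ H) {ψ₁ ψ₂ : H} (h₁ : ψ₁ ∈ L₁.submodule)
    (h₂ : ψ₂ ∈ L₂.submodule) (n₁ : ‖ψ₁‖ = 1) (n₂ : ‖ψ₂‖ = 1) :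
    transitionProb L₁ L₂ = ‖⟪ψ₁, ψ₂⟫_ℂ‖ ^ 2 := by
  obtain ⟨c₁, hc₁, rfl⟩ := exists_phase L₁ h₁ n₁
  obtain ⟨c₂, hc₂, rfl⟩ := exists_phase L₂ h₂ n₂
  simp only [transitionProb, inner_smul_left, inner_smul_right, norm_mul, RCLike.norm_conj, hc₁, hc₂,
    one_mul]

instance finiteDimensional_line (L : ℙ ℂ H) : FiniteDimensional ℂ L.submodule := by
  rw [Projectivization.submodule_eq]
  infer_instance

instance completeSpace_line (L : ℙ ℂ H) : CompleteSpace L.submodule :=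
  FiniteDimensional.complete ℂ L.submodule

/-- The tangent space `Hom_ℂ(L, Lᗮ)` of projective space at `L`. -/
def Tangent (L : ℙ ℂ H) : Type _ := L.submodule →L[ℂ] L.submoduleᗮ

instance (L : ℙ ℂ H) : NormedAddCommGroup (Tangent L) :=
  inferInstanceAs (NormedAddCommGroup (L.submodule →L[ℂ] L.submoduleᗮ))

instance (L : ℙ ℂ H) : NormedSpace ℂ (Tangent L) :=
  inferInstanceAs (NormedSpace ℂ (L.submodule →L[ℂ] L.submoduleᗮ))

/-- A tangent vector, regarded as a continuous linear map. -/
def Tangent.toHom {L : ℙ ℂ H} (f : Tangent L) : L.submodule →L[ℂ] L.submoduleᗮ := f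

instance (L : ℙ ℂ H) : CoeFun (Tangent L) (fun _ => L.submodule → L.submoduleᗮ) :=
  ⟨fun f => f.toHom⟩

/-- The domain of the affine chart centred at `L`: the lines that are not orthogonal to `L`,
that is, the graphs of linear maps `L → Lᗮ`. -/
def chartDomain (L : ℙ ℂ H) : Set (ℙ ℂ H) := {L' | ⟪L.rep, L'.rep⟫_ℂ ≠ 0}

/-- The affine chart of projective space centred at `L`. It sends a line `L'` in `chartDomain L`
to the linear map `L → Lᗮ` whose graph in `H = L ⊕ Lᗮ` is `L'`, see `mem_line_iff_chart`.
The differential of this chart identifies the tangent space at `L` with `Hom_ℂ(L, Lᗮ)`. -/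
def chart (L L' : ℙ ℂ H) : Tangent L :=
  ContinuousLinearMap.smulRight ((⟪L.rep, L'.rep⟫_ℂ)⁻¹ • (innerSL ℂ L.rep).comp L.submodule.subtypeL)
    (L.submoduleᗮ.orthogonalProjectionOnto L'.rep)

lemma chart_apply (L L' : ℙ ℂ H) (x : L.submodule) :
    chart L L' x = ((⟪L.rep, L'.rep⟫_ℂ)⁻¹ * ⟪L.rep, (x : H)⟫_ℂ) •
      L.submoduleᗮ.orthogonalProjectionOnto L'.rep := by
  simp [chart, Tangent.toHom]

/-- A line in the chart domain is the graph of its image under the chart. -/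
theorem mem_line_iff_chart (L L' : ℙ ℂ H) (h : L' ∈ chartDomain L) (y : H) :
    y ∈ L'.submodule ↔ ∃ x : L.submodule, y = (x : H) + (chart L L' x : H) := by
  have h' : ⟪L.rep, L'.rep⟫_ℂ ≠ 0 := h
  have key : ∀ (c : ℂ) (x : L.submodule),
      (x : H) = c • (L.submodule.orthogonalProjectionOnto L'.rep : H) →
      (x : H) + (chart L L' x : H) = c • L'.rep := by
    intro c x hx
    have hrep : L.rep ∈ L.submodule := (mem_submodule_iff L _).2 ⟨1, one_smul _ _⟩
    have hin : ⟪L.rep, (L.submodule.orthogonalProjectionOnto L'.rep : H)⟫_ℂ = ⟪L.rep, L'.rep⟫_ℂ :=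
      Submodule.inner_orthogonalProjectionOnto_eq_of_mem_left ⟨L.rep, hrep⟩ L'.rep
    have hsum : (L.submodule.orthogonalProjectionOnto L'.rep : H)
        + (L.submoduleᗮ.orthogonalProjectionOnto L'.rep : H) = L'.rep :=
      Submodule.starProjection_add_starProjection_orthogonal L'.rep
    rw [chart_apply, hx, inner_smul_right, hin]
    have hc : (⟪L.rep, L'.rep⟫_ℂ)⁻¹ * (c * ⟪L.rep, L'.rep⟫_ℂ) = c := by
      field_simp
    rw [hc, Submodule.coe_smul, ← smul_add, hsum]
  rw [mem_submodule_iff]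
  constructor
  · rintro ⟨c, rfl⟩
    exact ⟨c • L.submodule.orthogonalProjectionOnto L'.rep, (key c _ rfl).symm⟩
  · rintro ⟨x, rfl⟩
    have hrep : L.rep ∈ L.submodule := (mem_submodule_iff L _).2 ⟨1, one_smul _ _⟩
    have hin : ⟪L.rep, (L.submodule.orthogonalProjectionOnto L'.rep : H)⟫_ℂ = ⟪L.rep, L'.rep⟫_ℂ :=
      Submodule.inner_orthogonalProjectionOnto_eq_of_mem_left ⟨L.rep, hrep⟩ L'.rep
    obtain ⟨a, ha⟩ := (mem_submodule_iff L _).1 x.2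
    obtain ⟨b, hb⟩ := (mem_submodule_iff L _).1 (L.submodule.orthogonalProjectionOnto L'.rep).2
    have hb0 : b ≠ 0 := by
      rintro rfl
      rw [← hb] at hin
      simp at hin
      exact h' hin.symm
    refine ⟨a / b, (key (a / b) x ?_).symm⟩
    rw [← ha, ← hb, smul_smul, div_mul_cancel₀ _ hb0]

/-- The curve `γ` is of class `C¹` on the set `s`: near each of its points `γ t₀` it stays in the
affine chart centred at `γ t₀`, and it is `C¹` in this chart. -/
def IsC1Curve (γ : ℝ → ℙ ℂ H) (s : Set ℝ) : Prop :=
  ∀ t₀ ∈ s, (∀ᶠ t in 𝓝[s] t₀, γ t ∈ chartDomain (γ t₀)) ∧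
    ContDiffWithinAt ℝ 1 (fun t => chart (γ t₀) (γ t)) s t₀

/-- The velocity at `t` of a curve defined on `s`, an element of `Hom_ℂ(L, Lᗮ)` for `L = γ t`. -/
def velocity (γ : ℝ → ℙ ℂ H) (s : Set ℝ) (t : ℝ) : Tangent (γ t) :=
  derivWithin (fun r => chart (γ t) (γ r)) s t

variable [CompleteSpace H]

/-- The hermitian form `⟨f₁, f₂⟩ = Tr(f₁* f₂)` on the tangent space `Hom_ℂ(L, Lᗮ)`. -/
def hermitianForm (L : ℙ ℂ H) (f₁ f₂ : Tangent L) : ℂ :=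
  LinearMap.trace ℂ L.submodule
    (((ContinuousLinearMap.adjoint f₁.toHom).comp f₂.toHom : L.submodule →L[ℂ] L.submodule) :
      L.submodule →ₗ[ℂ] L.submodule)

/-- Evaluation at a unit vector of `L` is an isometry from `Hom_ℂ(L, Lᗮ)` onto `Lᗮ`. -/
theorem hermitianForm_eq (L : ℙ ℂ H) (f₁ f₂ : Tangent L) (l : L.submodule) (hl : ‖l‖ = 1) :
    hermitianForm L f₁ f₂ = ⟪f₁ l, f₂ l⟫_ℂ := by
  have h1 : Module.finrank ℂ L.submodule = 1 := Projectivization.finrank_submodule L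
  have hs : Orthonormal ℂ (fun _ : Unit => l) :=
    ⟨fun _ => hl, fun i j hij => (hij (Subsingleton.elim i j)).elim⟩
  have hspan : ⊤ ≤ Submodule.span ℂ (Set.range (fun _ : Unit => l)) := by
    rw [Set.range_const]
    intro x _
    have hl0 : l ≠ 0 := by
      rintro rfl
      simp at hl
    obtain ⟨c, hc⟩ := exists_smul_eq_of_finrank_eq_one h1 hl0 x
    exact Submodule.mem_span_singleton.2 ⟨c, hc⟩
  rw [hermitianForm, LinearMap.trace_eq_sum_inner _ (OrthonormalBasis.mk hs hspan)]
  simp [ContinuousLinearMap.adjoint_inner_right]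

/-- The Fubini–Study Riemannian metric, `g(f₁, f₂) = 4 Re Tr(f₁* f₂)`. The factor `4` normalizes
it so that complex projective lines are round 2-spheres of radius one: in the affine coordinate
`μ ↦ ℂ ∙ (e₁ + μ e₂)` of a projective line it reads `4 |dμ|² / (1 + |μ|²)²`. -/
def metric (L : ℙ ℂ H) (f₁ f₂ : Tangent L) : ℝ := 4 * (hermitianForm L f₁ f₂).re

/-- The length of a curve on `[0, 1]`. -/
def length (γ : ℝ → ℙ ℂ H) : ℝ≥0∞ :=
  ∫⁻ t in Set.Icc (0 : ℝ) 1, ENNReal.ofReal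
    (√(metric (γ t) (velocity γ (Set.Icc 0 1) t) (velocity γ (Set.Icc 0 1) t)))

/-- The Riemannian distance with values in `[0, ∞]`: the infimum of the lengths of the `C¹` curves
from `L₁` to `L₂`. -/
def fsEDist (L₁ L₂ : ℙ ℂ H) : ℝ≥0∞ :=
  ⨅ (γ : ℝ → ℙ ℂ H) (_ : IsC1Curve γ (Set.Icc 0 1)) (_ : γ 0 = L₁) (_ : γ 1 = L₂), length γ

/-- The Fubini–Study distance on projective space. -/
def fsDist (L₁ L₂ : ℙ ℂ H) : ℝ := (fsEDist L₁ L₂).toReal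

end FubiniStudy

end

namespace FubiniStudy

variable {H : Type*} [NormedAddCommGroup H] [InnerProductSpace ℂ H]

/-! Both bounds come from the angle `arccos (2p - 1)`, which is `2α` when `p = cos² α`.

Lower bound: along a `C¹` curve starting at `L₁`, let `p` be the transition probability to `L₁`.
Cauchy–Schwarz gives `|p'| ≤ σ √(p (1 - p))` with `σ` the Fubini–Study speed
(`exists_hasDerivWithinAt_transitionProb`). Since `1 - (2p - 1)² = 4p (1 - p)`, the angle changes at
rate at most `σ` wherever `arccos` is differentiable. It starts at `0`, so integration bounds its
final value by the length (`ofReal_arccos_le_length`).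

Upper bound: suitable unit vectors in two distinct lines span a great circle arc of angle `α ≤ π/2`
(`exists_arc`). Its image in projective space has constant speed `2α`, hence attains the bound
(`length_arcCurve`). -/

/-! ### Transition probability, charts and metric in terms of arbitrary representatives -/

lemma exists_unit_mem (L : ℙ ℂ H) : ∃ u ∈ L.submodule, ‖u‖ = 1 := by
  refine ⟨unitVec L, (mem_submodule_iff L _).2 ⟨_, rfl⟩, ?_⟩
  have hr : ‖L.rep‖ ≠ 0 := norm_ne_zero_iff.2 L.rep_nonzero
  rw [unitVec, norm_smul]
  simp [hr]

/-- The transition probability computed with a unit vector and an arbitrary nonzero vector. -/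
lemma transitionProb_eq_div (L₁ L₂ : ℙ ℂ H) {ψ v : H} (h₁ : ψ ∈ L₁.submodule)
    (h₂ : v ∈ L₂.submodule) (n₁ : ‖ψ‖ = 1) (hv : v ≠ 0) :
    transitionProb L₁ L₂ = ‖⟪ψ, v⟫_ℂ‖ ^ 2 / ‖v‖ ^ 2 := by
  have hv' : ‖v‖ ≠ 0 := norm_ne_zero_iff.2 hv
  rw [transitionProb_eq L₁ L₂ h₁ (L₂.submodule.smul_mem ((‖v‖⁻¹ : ℝ) : ℂ) h₂) n₁
    (by rw [norm_smul]; simp [hv']), inner_smul_right, norm_mul, mul_pow]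
  simp [div_eq_inv_mul]

lemma transitionProb_nonneg (L₁ L₂ : ℙ ℂ H) : 0 ≤ transitionProb L₁ L₂ := by
  unfold transitionProb; positivity

lemma transitionProb_le_one (L₁ L₂ : ℙ ℂ H) : transitionProb L₁ L₂ ≤ 1 := by
  obtain ⟨u, hu, nu⟩ := exists_unit_mem L₁
  obtain ⟨v, hv, nv⟩ := exists_unit_mem L₂
  rw [transitionProb_eq L₁ L₂ hu hv nu nv]
  have := norm_inner_le_norm (𝕜 := ℂ) u v
  rw [nu, nv, one_mul] at this
  exact pow_le_one₀ (norm_nonneg _) this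

lemma transitionProb_self (L : ℙ ℂ H) : transitionProb L L = 1 := by
  obtain ⟨u, hu, nu⟩ := exists_unit_mem L
  rw [transitionProb_eq L L hu hu nu nu, inner_self_eq_norm_sq_to_K, nu]
  simp

/-- The chart in terms of an arbitrary nonzero vector of each of the two lines. -/
lemma chart_eq (L L' : ℙ ℂ H) {u v : H} (hu : u ∈ L.submodule) (hv : v ∈ L'.submodule)
    (hu0 : u ≠ 0) (hv0 : v ≠ 0) :
    chart L L' = ContinuousLinearMap.smulRight
      ((⟪u, v⟫_ℂ)⁻¹ • (innerSL ℂ u).comp L.submodule.subtypeL)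
      (L.submoduleᗮ.orthogonalProjectionOnto v) := by
  obtain ⟨a, rfl⟩ := (mem_submodule_iff L u).1 hu
  obtain ⟨b, rfl⟩ := (mem_submodule_iff L' v).1 hv
  have ha : a ≠ 0 := by rintro rfl; simp at hu0
  have hb : b ≠ 0 := by rintro rfl; simp at hv0
  have ha' : (starRingEnd ℂ) a ≠ 0 := by simpa using ha
  unfold chart
  refine ContinuousLinearMap.ext fun x => ?_
  simp only [ContinuousLinearMap.smulRight_apply, FunLike.coe_smul, Pi.smul_apply,
    ContinuousLinearMap.comp_apply, Submodule.subtypeL_apply, innerSL_apply_apply, inner_smul_left,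
    inner_smul_right, map_smul, smul_smul, smul_eq_mul]
  congr 1
  field_simp

lemma chart_self (L : ℙ ℂ H) : chart L L = 0 := by
  obtain ⟨u, hu, nu⟩ := exists_unit_mem L
  have hu0 : u ≠ 0 := by rintro rfl; simp at nu
  rw [chart_eq L L hu hu hu0 hu0, Submodule.orthogonalProjectionOnto_orthogonal_apply_eq_zero hu]
  exact ContinuousLinearMap.ext fun x => smul_zero (_ : ℂ)

/-- As `L` is one-dimensional, `Tr(f* f)` is `‖f l‖²`; the factor `4` of the metric becomes the `2`
in the speed. -/
lemma metric_self [CompleteSpace H] (L : ℙ ℂ H) (f : Tangent L) (l : L.submodule) (hl : ‖l‖ = 1) :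
    √(metric L f f) = 2 * ‖f l‖ := by
  rw [metric, hermitianForm_eq L f f l hl, inner_self_eq_norm_sq_to_K, ← RCLike.ofReal_pow]
  change √(4 * ‖f l‖ ^ 2) = _
  rw [show 4 * ‖f l‖ ^ 2 = (2 * ‖f l‖) ^ 2 by ring]
  exact Real.sqrt_sq (by positivity)

/-! ### Lower bound for the length of a curve -/

/-- The derivative of the transition probability along a curve in a chart, bounded in terms of
the speed of the curve. -/
lemma exists_hasDerivWithinAt_transitionProb [CompleteSpace H] (L₁ : ℙ ℂ H) {γ : ℝ → ℙ ℂ H}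
    {s : Set ℝ} (hγ : IsC1Curve γ s) {t : ℝ} (ht : t ∈ s) :
    ∃ p' : ℝ, HasDerivWithinAt (fun r => transitionProb L₁ (γ r)) p' s t ∧
      |p'| ≤ √(metric (γ t) (velocity γ s t) (velocity γ s t)) *
        √(transitionProb L₁ (γ t) * (1 - transitionProb L₁ (γ t))) := by
  obtain ⟨ψ, hψ, nψ⟩ := exists_unit_mem L₁
  obtain ⟨u, hu, nu⟩ := exists_unit_mem (γ t)
  obtain ⟨hdom, hC⟩ := hγ t ht
  have hd : HasDerivWithinAt (fun r => chart (γ t) (γ r)) (velocity γ s t) s t :=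
    (hC.differentiableWithinAt one_ne_zero).hasDerivWithinAt
  let ev : Tangent (γ t) →L[ℝ] H :=
    ((γ t).submoduleᗮ.subtypeL.comp (ContinuousLinearMap.apply ℂ _ (⟨u, hu⟩ : (γ t).submodule))
      : ((γ t).submodule →L[ℂ] (γ t).submoduleᗮ) →L[ℂ] H).restrictScalars ℝ
  have hev : ∀ f, ev f = (f ⟨u, hu⟩ : H) := fun f => rfl
  set v : H := ev (velocity γ s t) with hv
  -- The graph description of the chart supplies a differentiable nonzero vector of `γ r` for `r`
  -- near `t`, equal to `u` at `t`.
  have hF : HasDerivWithinAt (fun r => u + ev (chart (γ t) (γ r))) v s t :=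
    (ev.hasFDerivAt.comp_hasDerivWithinAt t hd).const_add u
  have horth : ∀ f, ⟪u, ev f⟫_ℂ = 0 := fun f =>
    Submodule.inner_right_of_mem_orthogonal hu (f ⟨u, hu⟩).2
  have hFt : u + ev (chart (γ t) (γ t)) = u := by rw [chart_self]; simp
  have hne : ∀ f, u + ev f ≠ 0 := by
    intro f h0
    have := inner_add_right (𝕜 := ℂ) u u (ev f)
    rw [h0, horth, inner_self_eq_norm_sq_to_K, nu] at this
    simp at this
  have heq : ∀ r, γ r ∈ chartDomain (γ t) → transitionProb L₁ (γ r) =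
      ‖⟪ψ, u + ev (chart (γ t) (γ r))⟫_ℂ‖ ^ 2 / ‖u + ev (chart (γ t) (γ r))‖ ^ 2 := by
    intro r hr
    exact transitionProb_eq_div _ _ hψ ((mem_line_iff_chart _ _ hr _).2 ⟨⟨u, hu⟩, rfl⟩) nψ (hne _)
  have hI : HasDerivWithinAt (fun r => ⟪ψ, u + ev (chart (γ t) (γ r))⟫_ℂ) ⟪ψ, v⟫_ℂ s t := by
    have h := (hasDerivWithinAt_const t s ψ).inner ℂ hF
    rwa [inner_zero_left, add_zero] at h
  have hnum := hI.norm_sq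
  -- The squared norm is stationary at `t` because `v` is orthogonal to `u`, so only the numerator
  -- contributes to `p'`.
  have hden : HasDerivWithinAt (fun r => ‖u + ev (chart (γ t) (γ r))‖ ^ 2) 0 s t := by
    have h := Complex.reCLM.hasFDerivAt.comp_hasDerivWithinAt t (hF.inner ℂ hF)
    rw [hFt, hv, horth, inner_eq_zero_symm.1 (horth _), add_zero, map_zero] at h
    refine h.congr_of_mem (fun r _ => ?_) ht
    exact norm_sq_eq_re_inner (𝕜 := ℂ) _
  have hq := hnum.div hden (by simpa using hne _)
  rw [hFt, nu] at hq
  have hp : transitionProb L₁ (γ t) = ‖⟪ψ, u⟫_ℂ‖ ^ 2 := transitionProb_eq _ _ hψ hu nψ nu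
  have hvel : √(metric (γ t) (velocity γ s t) (velocity γ s t)) = 2 * ‖v‖ :=
    metric_self _ _ ⟨u, hu⟩ nu
  refine ⟨_, hq.congr_of_eventuallyEq_of_mem (hdom.mono heq) ht, ?_⟩
  rw [hvel, hp]
  -- Only the component of `ψ` orthogonal to `u` pairs with `v`; its squared norm is `1 - p`.
  have hb : ‖⟪ψ, v⟫_ℂ‖ ≤ ‖v‖ * √(1 - ‖⟪ψ, u⟫_ℂ‖ ^ 2) := by
    have h1 : ⟪ψ, v⟫_ℂ = ⟪ψ - ⟪u, ψ⟫_ℂ • u, v⟫_ℂ := by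
      rw [inner_sub_left, inner_smul_left, hv, horth]; simp
    have h2 : ‖ψ - ⟪u, ψ⟫_ℂ • u‖ ^ 2 = 1 - ‖⟪ψ, u⟫_ℂ‖ ^ 2 := by
      rw [@norm_sub_sq ℂ, inner_smul_right, ← inner_conj_symm u ψ, RCLike.conj_mul, norm_smul,
        nψ, nu, RCLike.norm_conj, ← RCLike.ofReal_pow, RCLike.ofReal_re]
      ring
    rw [h1, ← h2, Real.sqrt_sq (norm_nonneg _), mul_comm]
    exact norm_inner_le_norm _ _
  have hre : |⟪⟪ψ, u⟫_ℂ, ⟪ψ, v⟫_ℂ⟫_ℝ| ≤ ‖⟪ψ, u⟫_ℂ‖ * ‖⟪ψ, v⟫_ℂ‖ := abs_real_inner_le_norm _ _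
  rw [Real.sqrt_mul (by positivity), Real.sqrt_sq (norm_nonneg _)]
  simp only [one_pow, mul_one, mul_zero, sub_zero, div_one, abs_mul, abs_two]
  calc 2 * |⟪⟪ψ, u⟫_ℂ, ⟪ψ, v⟫_ℂ⟫_ℝ| ≤ 2 * (‖⟪ψ, u⟫_ℂ‖ * ‖⟪ψ, v⟫_ℂ‖) := by gcongr
    _ ≤ 2 * (‖⟪ψ, u⟫_ℂ‖ * (‖v‖ * √(1 - ‖⟪ψ, u⟫_ℂ‖ ^ 2))) := by gcongr
    _ = _ := by ring

/-- A bound for the increment of a real function by the integral of a bound for its derivative,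
which need not be measurable. -/
lemma ofReal_sub_le_lintegral {g : ℝ → ℝ} {φ : ℝ → ℝ} (hc : ContinuousOn g (Set.Icc 0 1))
    (hd : ∀ t ∈ Set.Ioo (0 : ℝ) 1, DifferentiableAt ℝ g t ∧ |deriv g t| ≤ φ t) :
    ENNReal.ofReal (g 1 - g 0) ≤ ∫⁻ t in Set.Icc (0 : ℝ) 1, ENNReal.ofReal (φ t) := by
  have h1 : ∫⁻ t in Set.Ioo (0 : ℝ) 1, ‖deriv g t‖ₑ ≤
      ∫⁻ t in Set.Icc (0 : ℝ) 1, ENNReal.ofReal (φ t) := by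
    refine le_trans (MeasureTheory.setLIntegral_mono' measurableSet_Ioo fun t ht => ?_)
      (MeasureTheory.lintegral_mono_set Set.Ioo_subset_Icc_self)
    rw [← ofReal_norm]
    exact ENNReal.ofReal_le_ofReal (hd t ht).2
  refine le_trans ?_ h1
  -- An infinite integral leaves nothing to prove; a finite one makes `deriv g`, which is always
  -- measurable, integrable, so the fundamental theorem of calculus applies.
  by_cases htop : ∫⁻ t in Set.Ioo (0 : ℝ) 1, ‖deriv g t‖ₑ = ⊤
  · simp [htop]
  have hint : MeasureTheory.IntegrableOn (deriv g) (Set.Ioo 0 1) :=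
    ⟨(measurable_deriv g).aestronglyMeasurable, lt_top_iff_ne_top.2 htop⟩
  have hftc := intervalIntegral.integral_eq_sub_of_hasDerivAt_of_le zero_le_one hc
    (fun t ht => (hd t ht).1.hasDerivAt)
    ((intervalIntegrable_iff_integrableOn_Ioo_of_le zero_le_one).2 hint)
  rw [← hftc, intervalIntegral.integral_of_le zero_le_one,
    MeasureTheory.integral_Ioc_eq_integral_Ioo]
  refine (ENNReal.ofReal_le_ofReal (le_abs_self _)).trans ?_
  rw [← Real.norm_eq_abs, ofReal_norm]
  exact MeasureTheory.enorm_integral_le_lintegral_enorm _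

/-- The length of a curve is at least the angle determined by the transition probability. -/
lemma ofReal_arccos_le_length [CompleteSpace H] {γ : ℝ → ℙ ℂ H}
    (hγ : IsC1Curve γ (Set.Icc 0 1)) :
    ENNReal.ofReal (Real.arccos (2 * transitionProb (γ 0) (γ 1) - 1)) ≤ length γ := by
  set w : ℝ → ℝ := fun t => 2 * transitionProb (γ 0) (γ t) - 1 with hw
  have hw_mem : ∀ t, w t ^ 2 ≤ 1 := fun t => by
    have h0 := transitionProb_nonneg (γ 0) (γ t)
    have h1 := transitionProb_le_one (γ 0) (γ t)
    simp only [hw]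
    nlinarith
  have hcontw : ContinuousOn w (Set.Icc 0 1) := fun t ht => by
    obtain ⟨p', hp', -⟩ := exists_hasDerivWithinAt_transitionProb (γ 0) hγ ht
    exact ((hp'.const_mul 2).sub_const 1).continuousWithinAt
  -- `arccos` is not differentiable at `±1`, and `w` equals `1` at `t = 0` and may return to `±1`.
  -- Scaling by `k < 1` keeps the argument inside `(-1, 1)`; then `k → 1`.
  have key : ∀ k ∈ Set.Ioo (0 : ℝ) 1,
      ENNReal.ofReal (Real.arccos (k * w 1) - Real.arccos (k * w 0)) ≤ length γ := by
    intro k hk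
    refine ofReal_sub_le_lintegral (g := fun t => Real.arccos (k * w t))
      (Real.continuous_arccos.comp_continuousOn (continuousOn_const.mul hcontw)) fun t ht => ?_
    obtain ⟨p', hp', hle⟩ := exists_hasDerivWithinAt_transitionProb (γ 0) hγ
      (Set.Ioo_subset_Icc_self ht)
    have hk2 : k ^ 2 < 1 := by nlinarith [hk.1, hk.2]
    have hlt : (k * w t) ^ 2 < 1 := by
      rw [mul_pow]; nlinarith [hw_mem t, sq_nonneg k]
    have hlt' := abs_lt.1 ((sq_lt_one_iff_abs_lt_one _).1 hlt)
    have hwd : HasDerivAt (fun t => k * w t) (k * (2 * p')) t :=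
      (((hp'.hasDerivAt (Icc_mem_nhds ht.1 ht.2)).const_mul 2).sub_const 1).const_mul k
    have hg := (Real.hasDerivAt_arccos hlt'.1.ne' hlt'.2.ne).comp t hwd
    refine ⟨hg.differentiableAt, ?_⟩
    have hg' : deriv (fun t => Real.arccos (k * w t)) t = _ := hg.deriv
    rw [hg']
    have hpos : 0 < √(1 - (k * w t) ^ 2) := Real.sqrt_pos.2 (by linarith)
    rw [abs_mul, abs_neg, abs_of_pos (by positivity), one_div, inv_mul_le_iff₀ hpos, abs_mul,
      abs_mul, abs_two, abs_of_pos hk.1, mul_comm √(1 - _)]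
    set σ := √(metric (γ t) (velocity γ (Set.Icc 0 1) t) (velocity γ (Set.Icc 0 1) t))
    have hσ : 0 ≤ σ := Real.sqrt_nonneg _
    set p := transitionProb (γ 0) (γ t) with hp
    calc k * (2 * |p'|) ≤ k * (2 * (σ * √(p * (1 - p)))) := by
          have := hk.1; gcongr
      _ = σ * (2 * k * √(p * (1 - p))) := by ring
      -- From `4p (1 - p) + (2p - 1)² = 1`, the squared inequality reduces to `k² ≤ 1`.
      _ ≤ σ * √(1 - (k * w t) ^ 2) := by
          refine mul_le_mul_of_nonneg_left (Real.le_sqrt_of_sq_le ?_) hσ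
          have hp0 := transitionProb_nonneg (γ 0) (γ t)
          have hp1 := transitionProb_le_one (γ 0) (γ t)
          rw [mul_pow, Real.sq_sqrt (mul_nonneg hp0 (by linarith))]
          simp only [hw]
          nlinarith
  have hw0 : w 0 = 1 := by simp only [hw, transitionProb_self]; norm_num
  have hlim : Filter.Tendsto (fun k : ℝ => ENNReal.ofReal
      (Real.arccos (k * w 1) - Real.arccos (k * w 0))) (𝓝[<] 1)
      (𝓝 (ENNReal.ofReal (Real.arccos (1 * w 1) - Real.arccos (1 * w 0)))) := by
    refine tendsto_nhdsWithin_of_tendsto_nhds (Continuous.tendsto ?_ 1)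
    refine ENNReal.continuous_ofReal.comp (Continuous.sub ?_ ?_) <;>
    exact Real.continuous_arccos.comp (continuous_id.mul continuous_const)
  have := le_of_tendsto hlim (Filter.mem_of_superset
    (Ioo_mem_nhdsLT (zero_lt_one : (0 : ℝ) < 1)) key)
  simpa [hw0] using this

/-! ### Great circle arcs and their length -/

/-- The great circle arc through the orthogonal vectors `ψ` and `e`. -/
noncomputable def arc (ψ e : H) (x : ℝ) : H := (Real.cos x : ℂ) • ψ + (Real.sin x : ℂ) • e

lemma inner_arc {ψ e : H} (hψ : ‖ψ‖ = 1) (he : ‖e‖ = 1) (h : ⟪ψ, e⟫_ℂ = 0) (x y : ℝ) :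
    ⟪arc ψ e x, arc ψ e y⟫_ℂ = (Real.cos (y - x) : ℂ) := by
  have h' : ⟪e, ψ⟫_ℂ = 0 := inner_eq_zero_symm.1 h
  simp only [arc, inner_add_left, inner_add_right, inner_smul_left, inner_smul_right, h, h',
    inner_self_eq_norm_sq_to_K, hψ, he, Complex.conj_ofReal, Real.cos_sub]
  push_cast
  ring

lemma norm_arc {ψ e : H} (hψ : ‖ψ‖ = 1) (he : ‖e‖ = 1) (h : ⟪ψ, e⟫_ℂ = 0) (x : ℝ) :
    ‖arc ψ e x‖ = 1 := by
  rw [norm_eq_sqrt_re_inner (𝕜 := ℂ), inner_arc hψ he h]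
  simp

lemma arc_ne_zero {ψ e : H} (hψ : ‖ψ‖ = 1) (he : ‖e‖ = 1) (h : ⟪ψ, e⟫_ℂ = 0) (x : ℝ) :
    arc ψ e x ≠ 0 := by
  rw [← norm_ne_zero_iff, norm_arc hψ he h]
  exact one_ne_zero

/-- Recentres the arc at parameter `x`: the shift by `π/2` gives the unit tangent there, so every
point of the arc can serve as the centre of a chart. -/
lemma arc_eq_add (ψ e : H) (x y : ℝ) :
    arc ψ e y = (Real.cos (y - x) : ℂ) • arc ψ e x +
      (Real.sin (y - x) : ℂ) • arc ψ e (x + Real.pi / 2) := by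
  have hc := Real.cos_add x (y - x)
  have hs := Real.sin_add x (y - x)
  rw [add_sub_cancel] at hc hs
  simp only [arc, Real.cos_add_pi_div_two, Real.sin_add_pi_div_two]
  nth_rw 1 [hc, hs]
  push_cast
  module

/-- The tangent vector at `L` that sends a unit vector `u` of `L` to the projection of `v`. -/
noncomputable def arcVelocity (L : ℙ ℂ H) (u v : H) : Tangent L :=
  ContinuousLinearMap.smulRight ((innerSL ℂ u).comp L.submodule.subtypeL)
    (L.submoduleᗮ.orthogonalProjectionOnto v)

/-- In the recentred frame the vector at `y` has components `cos (y - x)` and `sin (y - x)`, so its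
line is a graph of slope `tan (y - x)`. -/
lemma chart_arc {ψ e : H} (hψ : ‖ψ‖ = 1) (he : ‖e‖ = 1) (h : ⟪ψ, e⟫_ℂ = 0) {x y : ℝ}
    {L L' : ℙ ℂ H} (hL : arc ψ e x ∈ L.submodule) (hL' : arc ψ e y ∈ L'.submodule) :
    chart L L' = Real.tan (y - x) • arcVelocity L (arc ψ e x) (arc ψ e (x + Real.pi / 2)) := by
  rw [chart_eq L L' hL hL' (arc_ne_zero hψ he h x) (arc_ne_zero hψ he h y), inner_arc hψ he h]
  have hp : L.submoduleᗮ.orthogonalProjectionOnto (arc ψ e y) =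
      (Real.sin (y - x) : ℂ) •
        L.submoduleᗮ.orthogonalProjectionOnto (arc ψ e (x + Real.pi / 2)) := by
    rw [arc_eq_add ψ e x y, map_add, map_smul, map_smul,
      Submodule.orthogonalProjectionOnto_orthogonal_apply_eq_zero hL, smul_zero, zero_add]
  rw [hp, ← Complex.coe_smul]
  refine ContinuousLinearMap.ext fun z => ?_
  change ((Real.cos (y - x) : ℂ)⁻¹ * ⟪arc ψ e x, (z : H)⟫_ℂ) • (Real.sin (y - x) : ℂ) •
      L.submoduleᗮ.orthogonalProjectionOnto (arc ψ e (x + Real.pi / 2)) =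
    (Real.tan (y - x) : ℂ) • ⟪arc ψ e x, (z : H)⟫_ℂ •
      L.submoduleᗮ.orthogonalProjectionOnto (arc ψ e (x + Real.pi / 2))
  rw [smul_smul, smul_smul, Real.tan_eq_sin_div_cos]
  congr 1
  push_cast
  ring

/-- The curve in projective space that runs along a great circle arc with constant speed. -/
noncomputable def arcCurve {ψ e : H} (hψ : ‖ψ‖ = 1) (he : ‖e‖ = 1) (h : ⟪ψ, e⟫_ℂ = 0) (α t : ℝ) : ℙ ℂ H :=
  Projectivization.mk ℂ (arc ψ e (α * t)) (arc_ne_zero hψ he h _)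

section arcCurve

variable {ψ e : H} (hψ : ‖ψ‖ = 1) (he : ‖e‖ = 1) (h : ⟪ψ, e⟫_ℂ = 0) (α : ℝ)

lemma arc_mem_arcCurve (t : ℝ) : arc ψ e (α * t) ∈ (arcCurve hψ he h α t).submodule := by
  rw [arcCurve, Projectivization.submodule_mk]
  exact Submodule.mem_span_singleton_self _

lemma chart_arcCurve (t : ℝ) :
    (fun r => chart (arcCurve hψ he h α t) (arcCurve hψ he h α r)) = fun r =>
      Real.tan (α * r - α * t) • arcVelocity (arcCurve hψ he h α t) (arc ψ e (α * t))
        (arc ψ e (α * t + Real.pi / 2)) :=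
  funext fun r => chart_arc hψ he h (arc_mem_arcCurve hψ he h α t) (arc_mem_arcCurve hψ he h α r)

lemma mem_chartDomain_iff {L L' : ℙ ℂ H} {u v : H} (hu : u ∈ L.submodule) (hv : v ∈ L'.submodule)
    (hu0 : u ≠ 0) (hv0 : v ≠ 0) : L' ∈ chartDomain L ↔ ⟪u, v⟫_ℂ ≠ 0 := by
  obtain ⟨a, rfl⟩ := (mem_submodule_iff L u).1 hu
  obtain ⟨b, rfl⟩ := (mem_submodule_iff L' v).1 hv
  have ha : a ≠ 0 := by rintro rfl; simp at hu0
  have hb : b ≠ 0 := by rintro rfl; simp at hv0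
  simp [chartDomain, ha, hb]

lemma isC1Curve_arcCurve (s : Set ℝ) : IsC1Curve (arcCurve hψ he h α) s := by
  refine fun t _ => ⟨?_, ?_⟩
  · have hcont : Continuous fun r : ℝ => Real.cos (α * r - α * t) := by fun_prop
    have hne : ∀ᶠ r in 𝓝 t, Real.cos (α * r - α * t) ≠ 0 :=
      hcont.continuousAt.eventually_ne (by simp)
    filter_upwards [hne.filter_mono nhdsWithin_le_nhds] with r hr
    rw [mem_chartDomain_iff (arc_mem_arcCurve hψ he h α t) (arc_mem_arcCurve hψ he h α r)
      (arc_ne_zero hψ he h _) (arc_ne_zero hψ he h _), inner_arc hψ he h]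
    exact_mod_cast hr
  · rw [chart_arcCurve]
    have htan : ContDiffAt ℝ 1 (fun r : ℝ => Real.tan (α * r - α * t)) t :=
      ContDiffAt.comp (g := Real.tan) (f := fun r => α * r - α * t) t
        (Real.contDiffAt_tan.2 (by simp)) (by fun_prop)
    exact (htan.smul contDiffAt_const).contDiffWithinAt

lemma velocity_arcCurve {s : Set ℝ} {t : ℝ} (hs : UniqueDiffWithinAt ℝ s t) :
    velocity (arcCurve hψ he h α) s t = α • arcVelocity (arcCurve hψ he h α t) (arc ψ e (α * t))
      (arc ψ e (α * t + Real.pi / 2)) := by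
  rw [velocity, chart_arcCurve]
  have hin : HasDerivAt (fun r : ℝ => α * r - α * t) α t := by
    simpa using ((hasDerivAt_id t).const_mul α).sub_const (α * t)
  have htan : HasDerivAt (fun r : ℝ => Real.tan (α * r - α * t)) α t := by
    have := (Real.hasDerivAt_tan (x := α * t - α * t) (by simp)).comp t hin
    rw [sub_self, Real.cos_zero, one_pow, one_div_one, one_mul] at this
    exact this
  exact ((htan.smul_const _).hasDerivWithinAt).derivWithin hs

lemma norm_arcVelocity_apply (t : ℝ) :
    ‖arcVelocity (arcCurve hψ he h α t) (arc ψ e (α * t)) (arc ψ e (α * t + Real.pi / 2))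
      ⟨arc ψ e (α * t), arc_mem_arcCurve hψ he h α t⟩‖ = 1 := by
  have hmem : arc ψ e (α * t + Real.pi / 2) ∈ (arcCurve hψ he h α t).submoduleᗮ := by
    rw [arcCurve, Projectivization.submodule_mk, Submodule.mem_orthogonal_singleton_iff_inner_right,
      inner_arc hψ he h]
    simp
  change ‖⟪arc ψ e (α * t), arc ψ e (α * t)⟫_ℂ •
    (arcCurve hψ he h α t).submoduleᗮ.orthogonalProjectionOnto _‖ = 1
  have hn : ‖(arcCurve hψ he h α t).submoduleᗮ.orthogonalProjectionOnto
      (arc ψ e (α * t + Real.pi / 2))‖ = ‖arc ψ e (α * t + Real.pi / 2)‖ :=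
    congrArg norm (Submodule.starProjection_eq_self_iff.2 hmem)
  rw [inner_arc hψ he h, norm_smul, hn, norm_arc hψ he h]
  simp

/-- The speed is constant: `tan' 0 = 1` gives velocity `α` times a unit tangent vector, and the
metric doubles its norm. -/
lemma length_arcCurve [CompleteSpace H] (hα : 0 ≤ α) :
    length (arcCurve hψ he h α) = ENNReal.ofReal (2 * α) := by
  have hconst : ∀ t ∈ Set.Icc (0 : ℝ) 1, ENNReal.ofReal (√(metric (arcCurve hψ he h α t)
      (velocity (arcCurve hψ he h α) (Set.Icc 0 1) t)
      (velocity (arcCurve hψ he h α) (Set.Icc 0 1) t))) = ENNReal.ofReal (2 * α) := by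
    intro t ht
    rw [metric_self _ _ ⟨arc ψ e (α * t), arc_mem_arcCurve hψ he h α t⟩ (norm_arc hψ he h _),
      velocity_arcCurve hψ he h α (uniqueDiffOn_Icc zero_lt_one t ht)]
    change ENNReal.ofReal (2 * ‖α • (arcVelocity (arcCurve hψ he h α t) (arc ψ e (α * t))
      (arc ψ e (α * t + Real.pi / 2)) ⟨arc ψ e (α * t), arc_mem_arcCurve hψ he h α t⟩)‖) = _
    rw [norm_smul, norm_arcVelocity_apply, mul_one, Real.norm_of_nonneg hα]
  rw [length, MeasureTheory.setLIntegral_congr_fun measurableSet_Icc hconst]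
  simp

end arcCurve

/-! ### Upper bound for the distance -/

/-- Treated by the constant curve, since an arc needs a unit vector orthogonal to `L`, and none
exists if `H` is one-dimensional. -/
lemma fsEDist_self [CompleteSpace H] (L : ℙ ℂ H) : fsEDist L L = 0 := by
  have hγ : IsC1Curve (fun _ : ℝ => L) (Set.Icc 0 1) := fun t _ => by
    refine ⟨Filter.Eventually.of_forall fun _ => ?_, contDiffWithinAt_const⟩
    exact inner_self_ne_zero.2 L.rep_nonzero
  refine le_antisymm ?_ zero_le
  refine iInf_le_of_le (fun _ => L) (iInf_le_of_le hγ (iInf_le_of_le rfl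
    (iInf_le_of_le rfl (le_of_eq ?_))))
  have hv : ∀ t, velocity (fun _ : ℝ => L) (Set.Icc 0 1) t = 0 := fun t => by
    exact congrFun (derivWithin_fun_const (Set.Icc (0 : ℝ) 1) (chart L L)) t
  have hm : metric L 0 0 = 0 := by
    obtain ⟨u, hu, nu⟩ := exists_unit_mem L
    rw [metric, hermitianForm_eq L 0 0 ⟨u, hu⟩ nu]
    change 4 * (⟪(0 : L.submoduleᗮ), 0⟫_ℂ).re = 0
    simp
  simp only [length, hv, hm]
  simp

/-- Two distinct lines are joined by a great circle arc. -/
lemma exists_arc {L₁ L₂ : ℙ ℂ H} (hne : L₁ ≠ L₂) :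
    ∃ (ψ e : H) (α : ℝ), ‖ψ‖ = 1 ∧ ‖e‖ = 1 ∧ ⟪ψ, e⟫_ℂ = 0 ∧ 0 ≤ α ∧ α ≤ Real.pi / 2 ∧
      ψ ∈ L₁.submodule ∧ arc ψ e α ∈ L₂.submodule := by
  obtain ⟨ψ, hψ, nψ⟩ := exists_unit_mem L₁
  obtain ⟨φ₀, hφ₀, nφ₀⟩ := exists_unit_mem L₂
  -- A change of phase makes the inner product real and nonnegative, which puts the angle `arccos a`
  -- in `[0, π/2]`.
  obtain ⟨c, hc, hcφ⟩ : ∃ c : ℂ, ‖c‖ = 1 ∧ c * ⟪ψ, φ₀⟫_ℂ = (‖⟪ψ, φ₀⟫_ℂ‖ : ℂ) := by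
    obtain ⟨c, hc, h⟩ := RCLike.exists_norm_eq_mul_self (K := ℂ) ⟪ψ, φ₀⟫_ℂ
    exact ⟨c, hc, h.symm⟩
  set φ := c • φ₀ with hφdef
  have hφ : φ ∈ L₂.submodule := L₂.submodule.smul_mem c hφ₀
  have nφ : ‖φ‖ = 1 := by rw [hφdef, norm_smul, hc, nφ₀, one_mul]
  set a : ℝ := ‖⟪ψ, φ₀⟫_ℂ‖ with ha
  have hin : ⟪ψ, φ⟫_ℂ = (a : ℂ) := by rw [hφdef, inner_smul_right, hcφ]
  have ha0 : 0 ≤ a := norm_nonneg _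
  have ha1 : a ≤ 1 := by
    have := norm_inner_le_norm (𝕜 := ℂ) ψ φ₀
    rwa [nψ, nφ₀, one_mul] at this
  set η : H := φ - (a : ℂ) • ψ with hη
  have horth : ⟪ψ, η⟫_ℂ = 0 := by
    rw [hη, inner_sub_right, hin, inner_smul_right, inner_self_eq_norm_sq_to_K, nψ]
    simp
  have hnorm : ‖η‖ ^ 2 = 1 - a ^ 2 := by
    have h1 := norm_add_sq_eq_norm_sq_add_norm_sq_of_inner_eq_zero (𝕜 := ℂ) ((a : ℂ) • ψ) η
      (by rw [inner_smul_left, horth, mul_zero])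
    rw [hη, add_sub_cancel, nφ, norm_smul, nψ, Complex.norm_real, Real.norm_of_nonneg ha0,
      ← hη] at h1
    nlinarith
  have hη0 : ‖η‖ ≠ 0 := by
    intro h0
    apply hne
    have hφψ : φ = (a : ℂ) • ψ := sub_eq_zero.1 (norm_eq_zero.1 h0)
    have hφ0 : φ ≠ 0 := by rw [← norm_ne_zero_iff, nφ]; exact one_ne_zero
    have hψ0 : ψ ≠ 0 := by rw [← norm_ne_zero_iff, nψ]; exact one_ne_zero
    have hφ1 : φ ∈ L₁.submodule := hφψ ▸ L₁.submodule.smul_mem _ hψ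
    obtain ⟨b₁, hb₁⟩ := (mem_submodule_iff L₁ φ).1 hφ1
    obtain ⟨b₂, hb₂⟩ := (mem_submodule_iff L₂ φ).1 hφ
    have hb₁0 : b₁ ≠ 0 := by rintro rfl; exact hφ0 (by rw [← hb₁, zero_smul])
    rw [← L₁.mk_rep, ← L₂.mk_rep, Projectivization.mk_eq_mk_iff']
    refine ⟨b₁⁻¹ * b₂, ?_⟩
    rw [mul_smul, hb₂, ← hb₁, smul_smul, inv_mul_cancel₀ hb₁0, one_smul]
  refine ⟨ψ, ((‖η‖⁻¹ : ℝ) : ℂ) • η, Real.arccos a, nψ, ?_, ?_, Real.arccos_nonneg _,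
    Real.arccos_le_pi_div_two.2 ha0, hψ, ?_⟩
  · rw [norm_smul]; simp [hη0]
  · rw [inner_smul_right, horth, mul_zero]
  · have : arc ψ (((‖η‖⁻¹ : ℝ) : ℂ) • η) (Real.arccos a) = φ := by
      rw [arc, Real.cos_arccos (by linarith) ha1, Real.sin_arccos, ← hnorm,
        Real.sqrt_sq (norm_nonneg _), smul_smul, ← Complex.ofReal_mul, mul_inv_cancel₀ hη0, hη]
      simp
    rwa [this]

lemma eq_mk_of_mem {L : ℙ ℂ H} {v : H} (hv : v ∈ L.submodule) (hv0 : v ≠ 0) :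
    Projectivization.mk ℂ v hv0 = L := by
  obtain ⟨a, ha⟩ := (mem_submodule_iff L v).1 hv
  rw [← L.mk_rep, Projectivization.mk_eq_mk_iff']
  exact ⟨a, ha⟩

lemma fsEDist_le [CompleteSpace H] (L₁ L₂ : ℙ ℂ H) :
    fsEDist L₁ L₂ ≤ ENNReal.ofReal (Real.arccos (2 * transitionProb L₁ L₂ - 1)) := by
  rcases eq_or_ne L₁ L₂ with rfl | hne
  · rw [fsEDist_self]; exact zero_le
  obtain ⟨ψ, e, α, hψ, he, h, hα0, hα, hL₁, hL₂⟩ := exists_arc hne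
  have h0 : arc ψ e 0 = ψ := by simp [arc]
  have hp : transitionProb L₁ L₂ = Real.cos α ^ 2 := by
    rw [transitionProb_eq L₁ L₂ hL₁ hL₂ hψ (norm_arc hψ he h _)]
    have hin := inner_arc hψ he h 0 α
    rw [h0, sub_zero] at hin
    rw [hin, Complex.norm_real, Real.norm_eq_abs, sq_abs]
  -- The bound `α ≤ π/2` is what keeps `2α` in `[0, π]`, where `arccos` inverts `cos`.
  rw [hp, ← Real.cos_two_mul, Real.arccos_cos (by linarith) (by linarith),
    ← length_arcCurve hψ he h α hα0]
  refine iInf_le_of_le (arcCurve hψ he h α) (iInf_le_of_le (isC1Curve_arcCurve hψ he h α _)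
    (iInf_le_of_le ?_ (iInf_le_of_le ?_ le_rfl)))
  · exact eq_mk_of_mem (by rwa [mul_zero, h0]) _
  · exact eq_mk_of_mem (by rwa [mul_one]) _

lemma fsEDist_eq [CompleteSpace H] (L₁ L₂ : ℙ ℂ H) :
    fsEDist L₁ L₂ = ENNReal.ofReal (Real.arccos (2 * transitionProb L₁ L₂ - 1)) := by
  refine le_antisymm (fsEDist_le L₁ L₂) ?_
  refine le_iInf fun γ => le_iInf fun hγ => le_iInf fun h0 => le_iInf fun h1 => ?_
  subst h0 h1
  exact ofReal_arccos_le_length hγ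

end FubiniStudy

theorem theorem1 {H : Type*} [NormedAddCommGroup H] [InnerProductSpace ℂ H] [CompleteSpace H]
    (L₁ L₂ : ℙ ℂ H) :
    FubiniStudy.fsEDist L₁ L₂ ≠ ⊤ ∧
      Real.cos (FubiniStudy.fsDist L₁ L₂) = 2 * FubiniStudy.transitionProb L₁ L₂ - 1 ∧
      FubiniStudy.transitionProb L₁ L₂ = Real.cos (FubiniStudy.fsDist L₁ L₂ / 2) ^ 2 := by
  have hcos : Real.cos (FubiniStudy.fsDist L₁ L₂) =
      2 * FubiniStudy.transitionProb L₁ L₂ - 1 := by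
    have h0 := FubiniStudy.transitionProb_nonneg L₁ L₂
    have h1 := FubiniStudy.transitionProb_le_one L₁ L₂
    rw [FubiniStudy.fsDist, FubiniStudy.fsEDist_eq, ENNReal.toReal_ofReal (Real.arccos_nonneg _),
      Real.cos_arccos (by linarith) (by linarith)]
  refine ⟨by rw [FubiniStudy.fsEDist_eq]; exact ENNReal.ofReal_ne_top, hcos, ?_⟩
  rw [Real.cos_sq, mul_div_cancel₀ _ (two_ne_zero' ℝ), hcos]
  ring
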